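/- Let $\mathbb N_\Delta=\{0,1,2,\dots\}\cup\{\Delta\}$, where $\Delta$ is a graveyard state with $\Delta+k=k+\Delta=\Delta$ for all $k\in\mathbb N_\Delta$ and $\sum_{j=1}^{\Delta}k_j=\Delta$. Let $\{X_{nj}: n,j\ge 1\}$ be independent $\mathbb N_\Delta$-valued random variables on a probability space $(\Omega,\mathcal A,P)$ such that, for each $n$, all $X_{nj}$, $j\ge1$, have the same distribution, with weights $f_n[k]=P[X_{nj}=k]$, $k\ge 0$, generating function $f_n(s)=\sum_{k\ge0}f_n[k]s^k$, $s\in[0,1]$, and $P[X_{nj}=\Delta]=1-f_n(1)$. Assume $0<f_n'(1)<\infty$ for all $n\ge1$, where $f_n'(1)=\sum_{k\ge 0}k f_n[k]$. Define $$Z_0=1,\qquad Z_n=\sum_{j=1}^{Z_{n-1}}X_{nj},\quad n\ge1,$$ $\mu_0=1$, $\mu_n=\prod_{i=1}^n f_i'(1)$, and $\tau_a=\min\{n\ge1: Z_n\in\{0,\Delta\}\}$ with $\min\varnothing=\infty$. Suppose that there is a constant $c>0$ such that for all $n\ge1$ $$E[X_{n1}^2;X_{n1}\ge2]\le c\,E[X_{n1};X_{n1}\ge2]\,E[X_{n1}\mid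 X_{n1}\ge1],$$ where the state $\Delta$ is excluded from all these events, i.e. $X_{n1}\geq m$ means $m\le X_{n1}<\infty$, $X_{n1}\ne\Delta$. If $P[\tau_a=\infty]>0$, then there exists a non-negative (finite) random variable $W$ such that, almost surely on the event $\{\tau_a=\infty\}$, $$\frac{Z_n}{\mu_n}\longrightarrow W\quad (n\to\infty)\qquad\text{and}\qquad W>0.$$ -/

import Mathlib

open MeasureTheory ProbabilityTheory Filter Topology
open scoped ENNReal

namespace DefectiveGW

/-- The state space `ℕ₀ ∪ {Δ}`, with the discrete σ-algebra. The graveyard `Δ` is the element `⊤`;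
it is absorbing for addition. The order of `ℕ∞` plays no role for `Δ`. -/
abbrev NatDelta : Type := ℕ∞

/-- The graveyard state. -/
abbrev grave : NatDelta := ⊤

/-- The generating function `f(s) = ∑ₖ f[k] sᵏ` of a (possibly defective) distribution on `ℕ₀`,
that is, of a probability distribution on `ℕ₀ ∪ {Δ}`, with the convention `s^Δ = 0`. -/
noncomputable def genFun (f : PMF NatDelta) (s : ℝ) : ℝ :=
  ∑' k : ℕ, (f k).toReal * s ^ k

/-- `E[X ^ r; X ≥ m, X ≠ Δ]` for a random variable `X` with distribution `f`. -/
noncomputable def truncMoment (f : PMF NatDelta) (r m : ℕ) : ℝ≥0∞ :=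
  ∑' k : ℕ, if m ≤ k then (k : ℝ≥0∞) ^ r * f k else 0

/-- `f'(1) = ∑ₖ k f[k]`, a value in `[0, ∞]`. -/
noncomputable def derivOne (f : PMF NatDelta) : ℝ≥0∞ :=
  ∑' k : ℕ, (k : ℝ≥0∞) * f k

/-- If finite, `derivOne f` is the (left) derivative at `1` of the generating function on `[0, 1]`. -/
theorem hasDerivWithinAt_genFun (f : PMF NatDelta) (hf : derivOne f ≠ ∞) :
    HasDerivWithinAt (genFun f) (derivOne f).toReal (Set.Icc 0 1) 1 := by
  have hfin : ∀ k : ℕ, f (k : NatDelta) ≠ ∞ := fun k => f.apply_ne_top _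
  have hsum1 : Summable fun k : ℕ => (k : ℝ) * (f k).toReal := by
    have := ENNReal.summable_toReal hf
    simpa [ENNReal.toReal_mul] using this
  have hval : (derivOne f).toReal = ∑' k : ℕ, (k : ℝ) * (f k).toReal := by
    rw [derivOne, ENNReal.tsum_toReal_eq]
    · simp [ENNReal.toReal_mul]
    · intro k
      exact ENNReal.mul_ne_top (by simp) (hfin k)
  have hsum0 : Summable fun k : ℕ => (f k).toReal := by
    have h := ENNReal.summable_toReal f.tsum_coe_ne_top
    exact h.comp_injective (i := fun k : ℕ => (k : NatDelta)) (fun a b h => by simpa using h)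
  have hsums : ∀ s ∈ Set.Icc (0 : ℝ) 1, Summable fun k : ℕ => (f k).toReal * s ^ k := by
    intro s hs
    refine Summable.of_nonneg_of_le (fun k => mul_nonneg ENNReal.toReal_nonneg
      (pow_nonneg hs.1 k)) (fun k => ?_) hsum0
    exact mul_le_of_le_one_right ENNReal.toReal_nonneg (pow_le_one₀ hs.1 hs.2)
  rw [hasDerivWithinAt_iff_tendsto_slope, hval]
  have key : Tendsto (fun s : ℝ => ∑' k : ℕ, (f k).toReal * ∑ i ∈ Finset.range k, s ^ i)
      (𝓝[Set.Icc 0 1 \ {1}] 1) (𝓝 (∑' k : ℕ, (k : ℝ) * (f k).toReal)) := by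
    refine tendsto_tsum_of_dominated_convergence hsum1 (fun k => ?_) ?_
    · have hc : Continuous fun s : ℝ => (f k).toReal * ∑ i ∈ Finset.range k, s ^ i := by fun_prop
      have := (hc.tendsto 1).mono_left (nhdsWithin_le_nhds (s := Set.Icc 0 1 \ {1}))
      simpa [mul_comm] using this
    · filter_upwards [self_mem_nhdsWithin] with s hs k
      have hs0 : 0 ≤ s := hs.1.1
      have hnn : 0 ≤ ∑ i ∈ Finset.range k, s ^ i :=
        Finset.sum_nonneg fun i _ => pow_nonneg hs0 i
      rw [Real.norm_of_nonneg (mul_nonneg ENNReal.toReal_nonneg hnn), mul_comm]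
      refine mul_le_mul_of_nonneg_right ?_ ENNReal.toReal_nonneg
      calc ∑ i ∈ Finset.range k, s ^ i ≤ ∑ i ∈ Finset.range k, (1 : ℝ) :=
            Finset.sum_le_sum fun i _ => pow_le_one₀ hs0 hs.1.2
        _ = k := by simp
  refine key.congr' ?_
  filter_upwards [self_mem_nhdsWithin] with s hs
  have hs1 : s - 1 ≠ 0 := sub_ne_zero.mpr hs.2
  rw [slope_def_field, genFun, genFun,
    ← (hsums s hs.1).tsum_sub (hsums 1 (by simp)), ← tsum_div_const]
  refine tsum_congr fun k => ?_
  rw [geom_sum_eq hs.2]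
  field_simp
  ring

/-- `E[X | X ≥ 1]`, with `Δ` excluded from the event `X ≥ 1`. -/
noncomputable def condMean (f : PMF NatDelta) : ℝ≥0∞ :=
  truncMoment f 1 1 / truncMoment f 0 1

/-- `μₙ = ∏_{i=1}^n fᵢ'(1)`; here and below `f n` is the offspring distribution `f_{n+1}`. -/
noncomputable def mu (f : ℕ → PMF NatDelta) (n : ℕ) : ℝ :=
  ∏ i ∈ Finset.range n, (derivOne (f i)).toReal

/-- The random sum `∑_{j=1}^k x_j` with `k ∈ ℕ₀ ∪ {Δ}`, where an empty sum is `0` and a sum with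
`Δ` terms is `Δ`; here `x j` is the term `x_{j+1}`. -/
noncomputable def sumTo (x : ℕ → NatDelta) (k : NatDelta) : NatDelta :=
  open Classical in if k = grave then grave else ∑ j ∈ Finset.range k.toNat, x j

variable {Ω : Type*}

/-- The process `Z₀ = 1`, `Zₙ = ∑_{j=1}^{Zₙ₋₁} X_{nj}`; here `X n j` is `X_{n+1,j+1}`. -/
noncomputable def Z (X : ℕ → ℕ → Ω → NatDelta) : ℕ → Ω → NatDelta
  | 0, _ => 1
  | n + 1, ω => sumTo (fun j => X n j ω) (Z X n ω)

/-- `min {n ≥ 1 : Zₙ = z}`, with `min ∅ = ∞`. -/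
noncomputable def hitTime (X : ℕ → ℕ → Ω → NatDelta) (z : NatDelta) (ω : Ω) : ℕ∞ :=
  ⨅ (n : ℕ) (_ : 1 ≤ n ∧ Z X n ω = z), (n : ℕ∞)

/-- The ultimate absorption time `τ_a = τ_0 ∧ τ_Δ`. -/
noncomputable def tauA (X : ℕ → ℕ → Ω → NatDelta) (ω : Ω) : ℕ∞ :=
  min (hitTime X 0 ω) (hitTime X grave ω)

/-- `X` is an offspring family in the varying environment `f`: the `X n j` are independent random
variables, `X n j` has distribution `f n`, and `0 < fₙ'(1) < ∞` for all `n`. -/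
structure IsOffspringFamily [MeasurableSpace Ω] (P : Measure Ω) (f : ℕ → PMF NatDelta)
    (X : ℕ → ℕ → Ω → NatDelta) : Prop where
  measurable : ∀ n j, Measurable (X n j)
  indep : iIndepFun (fun nj : ℕ × ℕ => X nj.1 nj.2) P
  law : ∀ n j k, P {ω | X n j ω = k} = f n k
  deriv_pos : ∀ n, 0 < derivOne (f n)
  deriv_lt_top : ∀ n, derivOne (f n) < ∞

end DefectiveGW

/-! The process `Z n / μ n`, set to `0` in the graveyard, is a non-negative supermartingale, so it
converges a.s. to a finite `W`. It remains to show that the event `E` of survival with `W = 0` is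
null. By Lévy's upward theorem it suffices that `C * P(A ∩ E) ≤ P(A \ E)` for all events `A` of the
past, with one constant `C > 0` (`measure_eq_zero_of_forall_mul_le`).

This inequality comes from comparing survival with normalized size. Follow one particle of
generation `n` through `k` further generations. Let `y` be the probability that its progeny is then
neither `0` nor `Δ`, and let `x = 1 - E[s ^ progeny]` with `s = exp(-μ n / μ (n + k))`. Then `y ≤ (K
+ 1) x` with `K = max 1 (4c)`, uniformly in `n` and `k` (`iterGen_sub_le`). As `k → ∞`, the variable
behind `x` becomes `1 - exp(-μ n * W)` on survival, which vanishes on `E`.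

The comparison rests on reciprocals of increments. With `D t = f 1 - f (1 - t)` and `m = f' 1`, the
error `1 / D t - 1 / (m t)` lies between `φ / 2` and `2 c φ`, where `φ = 1 / P(X ≥ 1) - 1 / m`
(`exists_shape_bounds`); the moment condition gives the upper bound. Under composition these errors
add up, so those accumulated by `1 / x` are at most `K` times those of `1 / y`, whatever the
environment (`iterGen_sub_le_mul`). -/

namespace DefectiveGW

/-! ### Bounds on the increment of a generating function at `1` -/

section Shape

theorem one_sub_pow_mul_le_one {t : ℝ} (h1 : t ≤ 1) (j : ℕ) :
    (1 - t) ^ j * (1 + j * t) ≤ 1 := by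
  induction j with
  | zero => simp
  | succ j ih =>
    refine le_trans ?_ ih
    have hp : 0 ≤ (1 - t) ^ j := pow_nonneg (by linarith) j
    have : (1 - t) ^ (j + 1) * (1 + ((j + 1 : ℕ) : ℝ) * t)
        = (1 - t) ^ j * (1 + j * t - (j + 1) * t ^ 2) := by
      push_cast; ring
    rw [this]
    refine mul_le_mul_of_nonneg_left ?_ hp
    have : 0 ≤ ((j : ℝ) + 1) * t ^ 2 := by positivity
    linarith

/-- A quadratic minorant of `k ↦ 1 - (1 - t) ^ k`. -/
theorem le_one_sub_one_sub_pow {t : ℝ} (h0 : 0 ≤ t) (h1 : t ≤ 1) (a : ℝ) (k : ℕ) :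
    t * ((2 * a - a ^ 2) * k - a ^ 2 * t * (k * (k - 1))) ≤ 1 - (1 - t) ^ k := by
  rcases k with _ | j
  · simp
  have hb := one_sub_pow_mul_le_one h1 j
  have hv : 0 < 1 + (j : ℝ) * t := by positivity
  have h2 : (1 - t) ^ (j + 1) * (1 + j * t) ≤ 1 - t := by
    rw [pow_succ]
    nlinarith
  have h3 : ((j : ℝ) + 1) * t / (1 + j * t) ≤ 1 - (1 - t) ^ (j + 1) := by
    rw [div_le_iff₀ hv]
    linarith
  refine le_trans ?_ h3
  rw [le_div_iff₀ hv]
  push_cast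
  -- With `v = 1 + j t`, the square `(a v - 1) ^ 2 ≥ 0` says `1 / v ≥ 2 a - a ^ 2 v`, which
  -- linearizes `h3`.
  have h4 : 0 ≤ ((j : ℝ) + 1) * t * (a * (1 + j * t) - 1) ^ 2 := by positivity
  linarith

/-- The quotient `2kt / (2 - t + kt)` is concave in `k`, ready for Jensen, and exact at `k = 0` and
`k = 1`. Exactness at `1` makes the error term vanish when `X ≤ 1`. -/
theorem one_sub_one_sub_pow_mul_le {t : ℝ} (h0 : 0 ≤ t) (h1 : t ≤ 1) (k : ℕ) :
    (1 - (1 - t) ^ k) * (2 - t + k * t) ≤ 2 * k * t := by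
  induction k with
  | zero => simp
  | succ k ih =>
    have hd : 0 < 2 - t + k * t := by
      have : 0 ≤ (k : ℝ) * t := by positivity
      linarith
    have hk : 0 ≤ (k : ℝ) * t * (t + k * t) := by positivity
    set u := 1 - (1 - t) ^ k with hu
    have hs : 1 - (1 - t) ^ (k + 1) = t + (1 - t) * u := by rw [hu, pow_succ]; ring
    have hu' : u ≤ 2 * k * t / (2 - t + k * t) := (le_div_iff₀ hd).2 ih
    rw [hs]
    push_cast
    have hle : t + (1 - t) * u ≤ t + (1 - t) * (2 * k * t / (2 - t + k * t)) := by
      have := mul_le_mul_of_nonneg_left hu' (sub_nonneg.2 h1)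
      linarith
    refine le_trans (mul_le_mul_of_nonneg_right hle (by linarith [mul_nonneg (Nat.cast_nonneg (α := ℝ) k) h0])) ?_
    have e : (t + (1 - t) * (2 * k * t / (2 - t + k * t))) * (2 - t + (k + 1) * t)
        = t * ((2 - t + k * t) + (1 - t) * (2 * k)) * (2 + k * t) / (2 - t + k * t) := by
      rw [← mul_div_assoc, add_div' _ _ _ hd.ne', div_mul_eq_mul_div]
      congr 1
      ring
    rw [e, div_le_iff₀ hd]
    nlinarith [mul_nonneg h0 hk]

/-- An affine majorant of `k ↦ 1 - (1 - t) ^ k` on `k ≥ 1`. -/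
theorem one_sub_one_sub_pow_le_affine {t M : ℝ} (h0 : 0 ≤ t) (h1 : t ≤ 1) (hM : 0 ≤ M) {k : ℕ} :
    1 - (1 - t) ^ k ≤ 2 * t / (2 - t + M * t) * M
      + 2 * t * (2 - t) / (2 - t + M * t) ^ 2 * (k - M) := by
  have hk : 0 ≤ (k : ℝ) * t := by positivity
  have hMt : 0 ≤ M * t := by positivity
  have hd : 0 < 2 - t + k * t := by linarith
  have hD : 0 < 2 - t + M * t := by linarith
  have h := (le_div_iff₀ hd).2 (one_sub_one_sub_pow_mul_le h0 h1 k)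
  refine h.trans ?_
  rw [← sub_nonneg]
  -- The majorant is the tangent at `k = M` of the concave function `2xt / (2 - t + xt)`, so the gap
  -- is a multiple of `(k - M) ^ 2`.
  have e : 2 * t / (2 - t + M * t) * M + 2 * t * (2 - t) / (2 - t + M * t) ^ 2 * (k - M)
      - 2 * k * t / (2 - t + k * t)
      = 2 * t * (2 - t) * t * (k - M) ^ 2 / ((2 - t + M * t) ^ 2 * (2 - t + k * t)) := by
    have hdn := hd.ne'
    have hDn := hD.ne'
    rw [div_mul_eq_mul_div, div_mul_eq_mul_div, div_add_div _ _ hDn (pow_ne_zero 2 hDn),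
      div_sub_div _ _ (by positivity) hdn, div_eq_div_iff (by positivity) (by positivity)]
    ring
  rw [e]
  have : 0 ≤ 2 - t := by linarith
  positivity

variable {w : ℕ → ℝ} {m p B D t : ℝ}

theorem mul_sq_le_of_hasSum (hw : ∀ k, 0 ≤ w k) (hm : 0 < m)
    (h1 : HasSum (fun k : ℕ => k * w k) m) (h2 : HasSum (fun k : ℕ => k * (k - 1) * w k) B)
    (hB : 0 ≤ B) (ht0 : 0 ≤ t) (ht1 : t ≤ 1)
    (hD : HasSum (fun k : ℕ => w k * (1 - (1 - t) ^ k)) D) :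
    m ^ 2 * t / (m + t * B) ≤ D := by
  have hpos : 0 < m + t * B := by positivity
  -- This `a` maximizes the summed minorant `t (2 a m - a ^ 2 (m + t B))`.
  set a := m / (m + t * B) with ha
  have key : HasSum (fun k : ℕ => t * ((2 * a - a ^ 2) * (k * w k)
      - a ^ 2 * t * (k * (k - 1) * w k))) (t * ((2 * a - a ^ 2) * m - a ^ 2 * t * B)) :=
    ((h1.mul_left _).sub (h2.mul_left _)).mul_left t
  have hle := hasSum_le (fun k => ?_) key hD
  · refine le_trans (le_of_eq ?_) hle
    rw [ha]
    field_simp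
    ring
  · have := mul_le_mul_of_nonneg_left (le_one_sub_one_sub_pow ht0 ht1 a k) (hw k)
    linarith

/-- Jensen's inequality conditionally on `X ≥ 1`: the tangent is taken at the conditional mean `m /
p`. -/
theorem le_of_hasSum_affine (hw : ∀ k, 0 ≤ w k) (hp : 0 < p) (hm : 0 < m)
    (h0 : HasSum (fun k : ℕ => if 1 ≤ k then w k else 0) p)
    (h1 : HasSum (fun k : ℕ => k * w k) m) (ht0 : 0 ≤ t) (ht1 : t ≤ 1)
    (hD : HasSum (fun k : ℕ => w k * (1 - (1 - t) ^ k)) D) :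
    D ≤ 2 * t * m / (2 - t + m / p * t) := by
  set M := m / p with hM
  have hMpos : 0 < M := by positivity
  set α := 2 * t / (2 - t + M * t)
  set β := 2 * t * (2 - t) / (2 - t + M * t) ^ 2
  have key : HasSum (fun k : ℕ => (α * M - β * M) * (if 1 ≤ k then w k else 0) + β * (k * w k))
      ((α * M - β * M) * p + β * m) := (h0.mul_left _).add (h1.mul_left _)
  have hle := hasSum_le (fun k => ?_) hD key
  · refine hle.trans (le_of_eq ?_)
    have : M * p = m := by rw [hM]; field_simp
    calc (α * M - β * M) * p + β * m = α * (M * p) - β * (M * p) + β * m := by ring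
      _ = _ := by rw [this]; simp only [α]; ring
  · rcases k with _ | k
    · simp
    · have := mul_le_mul_of_nonneg_left
        (one_sub_one_sub_pow_le_affine ht0 ht1 hMpos.le (k := k + 1)) (hw (k + 1))
      simp only [le_add_iff_nonneg_left, zero_le, if_true]
      simp only [α, β]
      linarith

end Shape

/-! ### Generating functions and moments of a defective law -/

section Weights

variable (f : PMF NatDelta)

theorem summable_weight : Summable fun k : ℕ => (f k).toReal := by
  have h := ENNReal.summable_toReal f.tsum_coe_ne_top
  exact h.comp_injective (i := fun k : ℕ => (k : NatDelta)) (fun a b h => by simpa using h)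

theorem summable_weight_mul_pow {s : ℝ} (h0 : 0 ≤ s) (h1 : s ≤ 1) :
    Summable fun k : ℕ => (f k).toReal * s ^ k :=
  (summable_weight f).of_nonneg_of_le
    (fun k => mul_nonneg ENNReal.toReal_nonneg (pow_nonneg h0 k))
    (fun _ => mul_le_of_le_one_right ENNReal.toReal_nonneg (pow_le_one₀ h0 h1))

theorem hasSum_genFun {s : ℝ} (h0 : 0 ≤ s) (h1 : s ≤ 1) :
    HasSum (fun k : ℕ => (f k).toReal * s ^ k) (genFun f s) :=
  (summable_weight_mul_pow f h0 h1).hasSum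

theorem genFun_nonneg {s : ℝ} (h0 : 0 ≤ s) : 0 ≤ genFun f s :=
  tsum_nonneg fun k => mul_nonneg ENNReal.toReal_nonneg (pow_nonneg h0 k)

theorem genFun_mono {s s' : ℝ} (h0 : 0 ≤ s) (h : s ≤ s') (h1 : s' ≤ 1) :
    genFun f s ≤ genFun f s' :=
  hasSum_le (fun k => mul_le_mul_of_nonneg_left (pow_le_pow_left₀ h0 h k) ENNReal.toReal_nonneg)
    (hasSum_genFun f h0 (h.trans h1)) (hasSum_genFun f (h0.trans h) h1)

theorem genFun_one_le_one : genFun f 1 ≤ 1 := by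
  have h2 : ∑' k : ℕ, f k ≤ 1 := by
    rw [← f.tsum_coe]
    exact ENNReal.tsum_comp_le_tsum_of_injective (f := fun k : ℕ => (k : NatDelta))
      (fun a b h => by simpa using h) f
  have : genFun f 1 = (∑' k : ℕ, f k).toReal := by
    rw [ENNReal.tsum_toReal_eq fun k => f.apply_ne_top _]
    simp [genFun]
  rw [this]
  exact ENNReal.toReal_le_of_le_ofReal zero_le_one (by simpa using h2)

theorem genFun_mem {s : ℝ} (hs : s ∈ Set.Icc (0 : ℝ) 1) : genFun f s ∈ Set.Icc (0 : ℝ) 1 :=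
  ⟨genFun_nonneg f hs.1, (genFun_mono f hs.1 hs.2 le_rfl).trans (genFun_one_le_one f)⟩

/-- Differences of a generating function are largest at `1`. -/
theorem genFun_sub_le {a b : ℝ} (hb : 0 ≤ b) (hab : b ≤ a) (ha : a ≤ 1) :
    genFun f a - genFun f b ≤ genFun f 1 - genFun f (1 - (a - b)) := by
  refine hasSum_le (fun k => ?_)
    ((hasSum_genFun f (hb.trans hab) ha).sub (hasSum_genFun f hb (hab.trans ha)))
    ((hasSum_genFun f zero_le_one le_rfl).sub
      (hasSum_genFun f (s := 1 - (a - b)) (by linarith) (by linarith)))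
  rw [← mul_sub, ← mul_sub]
  refine mul_le_mul_of_nonneg_left ?_ ENNReal.toReal_nonneg
  -- The factor `x - y` is `a - b` on both sides; the geometric sums compare termwise since `a ≤ 1`
  -- and `b ≤ 1 - (a - b)`.
  have e : ∀ x y : ℝ, x ^ k - y ^ k = (∑ i ∈ Finset.range k, x ^ i * y ^ (k - 1 - i)) * (x - y) :=
    fun x y => ((Commute.all x y).geom_sum₂_mul k).symm
  rw [e, e, sub_sub_cancel]
  refine mul_le_mul_of_nonneg_right (Finset.sum_le_sum fun i _ => ?_) (sub_nonneg.2 hab)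
  exact mul_le_mul (pow_le_pow_left₀ (hb.trans hab) ha i)
    (pow_le_pow_left₀ hb (by linarith) _) (pow_nonneg hb _) (by positivity)

variable {f}

/-- The subtraction is truncated, so the series is `E[(X - 1)⁺]`. It serves to express this moment
as `m - p`. -/
theorem tsum_succ_sub_add (f : PMF NatDelta) :
    (∑' k : ℕ, ((k - 1 : ℕ) : ℝ≥0∞) * f k) + truncMoment f 0 1 = derivOne f := by
  rw [truncMoment, ← ENNReal.tsum_add]
  refine tsum_congr fun k => ?_
  rcases k with _ | k
  · simp
  · simp [add_mul]

theorem truncMoment_one_one : truncMoment f 1 1 = derivOne f :=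
  tsum_congr fun k => by rcases k with _ | k <;> simp

theorem truncMoment_one_two_le :
    truncMoment f 1 2 ≤ 2 * ∑' k : ℕ, ((k - 1 : ℕ) : ℝ≥0∞) * f k := by
  rw [← ENNReal.tsum_mul_left]
  refine ENNReal.tsum_le_tsum fun k => ?_
  split_ifs with h
  · rw [pow_one, ← mul_assoc]
    gcongr
    exact_mod_cast (by omega : k ≤ 2 * (k - 1))
  · exact zero_le

theorem tsum_factorial_moment_le :
    ∑' k : ℕ, ((k * (k - 1) : ℕ) : ℝ≥0∞) * f k ≤ truncMoment f 2 2 := by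
  refine ENNReal.tsum_le_tsum fun k => ?_
  split_ifs with h
  · gcongr
    rw [sq]
    exact_mod_cast Nat.mul_le_mul_left k (Nat.sub_le k 1)
  · have : k = 0 ∨ k = 1 := by omega
    rcases this with rfl | rfl <;> simp

theorem truncMoment_zero_one_ne_zero (hpos : 0 < derivOne f) : truncMoment f 0 1 ≠ 0 := by
  intro h
  refine hpos.ne' ?_
  rw [truncMoment, ENNReal.tsum_eq_zero] at h
  rw [derivOne, ENNReal.tsum_eq_zero]
  intro k
  rcases k with _ | k
  · simp
  · have := h (k + 1)
    simp only [le_add_iff_nonneg_left, zero_le, if_true, pow_zero, one_mul] at this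
    rw [this, mul_zero]

/-- Two-sided bounds on the increment of the generating function at `1`, in terms of the
quantity `1 / P(X ≥ 1) - 1 / E[X]`. -/
theorem exists_shape_bounds (hpos : 0 < derivOne f) (hfin : derivOne f < ∞) {c : ℝ} (hc : 0 < c)
    (hcond : truncMoment f 2 2 ≤ ENNReal.ofReal c * truncMoment f 1 2 * condMean f) :
    ∃ φ : ℝ, 0 ≤ φ ∧ ∀ t : ℝ, 0 < t → t ≤ 1 →
      0 < genFun f 1 - genFun f (1 - t) ∧
      1 / (genFun f 1 - genFun f (1 - t)) ≤ 1 / ((derivOne f).toReal * t) + 2 * c * φ ∧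
      1 / ((derivOne f).toReal * t) + φ / 2 ≤ 1 / (genFun f 1 - genFun f (1 - t)) := by
  have hP0 := truncMoment_zero_one_ne_zero hpos
  have hsplit := tsum_succ_sub_add f
  set E : ℝ≥0∞ := ∑' k : ℕ, ((k - 1 : ℕ) : ℝ≥0∞) * f k with hE
  set Pe := truncMoment f 0 1 with hPe
  have hPfin : Pe ≠ ∞ := ne_top_of_le_ne_top hfin.ne (hsplit ▸ le_add_self)
  have hEfin : E ≠ ∞ := ne_top_of_le_ne_top hfin.ne (hsplit ▸ le_self_add)
  set Be : ℝ≥0∞ := ∑' k : ℕ, ((k * (k - 1) : ℕ) : ℝ≥0∞) * f k with hBe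
  -- In real terms `B ≤ 2c (m - p) m / p`; division by `m ^ 2` turns the right side into `2 c φ`.
  have hBle : Be ≤ ENNReal.ofReal c * (2 * E) * (derivOne f / Pe) := by
    refine tsum_factorial_moment_le.trans (hcond.trans ?_)
    rw [condMean, truncMoment_one_one]
    gcongr
    exact truncMoment_one_two_le
  have hrhs : ENNReal.ofReal c * (2 * E) * (derivOne f / Pe) ≠ ∞ := by
    refine ENNReal.mul_ne_top (ENNReal.mul_ne_top (by simp) (ENNReal.mul_ne_top (by simp) hEfin)) ?_
    exact (ENNReal.div_lt_top hfin.ne hP0).ne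
  have hBfin : Be ≠ ∞ := ne_top_of_le_ne_top hrhs hBle
  set m := (derivOne f).toReal with hm
  set p := Pe.toReal with hp
  set B := Be.toReal with hB
  have hmpos : 0 < m := ENNReal.toReal_pos hpos.ne' hfin.ne
  have hppos : 0 < p := ENNReal.toReal_pos hP0 hPfin
  have hEm : E.toReal = m - p := by
    rw [hm, ← hsplit, ENNReal.toReal_add hEfin hPfin]; ring
  have hpm : p ≤ m := by
    have : 0 ≤ E.toReal := ENNReal.toReal_nonneg
    linarith
  have hBr : B ≤ c * (2 * (m - p)) * (m / p) := by
    have := ENNReal.toReal_mono hrhs hBle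
    simpa [ENNReal.toReal_mul, ENNReal.toReal_div, hc.le, hEm] using this
  have hsum : ∀ {g : ℕ → ℝ≥0∞}, ∑' k, g k ≠ ∞ → HasSum (fun k => (g k).toReal) (∑' k, g k).toReal :=
    fun {g} hg => by
      rw [ENNReal.tsum_toReal_eq fun k => ENNReal.ne_top_of_tsum_ne_top hg k]
      exact (ENNReal.summable_toReal hg).hasSum
  have h1 : HasSum (fun k : ℕ => (k : ℝ) * (f k).toReal) m := by
    simpa [ENNReal.toReal_mul, hm, derivOne] using hsum (g := fun k : ℕ => (k : ℝ≥0∞) * f k) hfin.ne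
  have h2 : HasSum (fun k : ℕ => (k : ℝ) * (k - 1) * (f k).toReal) B := by
    refine (hsum hBfin).congr_fun fun k => ?_
    rcases k with _ | k
    · simp
    · rw [ENNReal.toReal_mul, ENNReal.toReal_natCast]
      simp
  have h0 : HasSum (fun k : ℕ => if 1 ≤ k then (f k).toReal else 0) p := by
    refine (hsum (g := fun k : ℕ => if 1 ≤ k then (k : ℝ≥0∞) ^ 0 * f k else 0) hPfin).congr_fun ?_
    intro k
    split_ifs <;> simp
  have hw : ∀ k : ℕ, 0 ≤ (f k).toReal := fun k => ENNReal.toReal_nonneg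
  have hB0 : 0 ≤ B := ENNReal.toReal_nonneg
  refine ⟨1 / p - 1 / m, sub_nonneg.2 (one_div_le_one_div_of_le hppos hpm), fun t ht0 ht1 => ?_⟩
  have hD : HasSum (fun k : ℕ => (f k).toReal * (1 - (1 - t) ^ k))
      (genFun f 1 - genFun f (1 - t)) := by
    refine ((hasSum_genFun f zero_le_one le_rfl).sub
      (hasSum_genFun f (s := 1 - t) (by linarith) (by linarith))).congr_fun fun k => ?_
    rw [one_pow, mul_sub]
  have hL := mul_sq_le_of_hasSum hw hmpos h1 h2 hB0 ht0.le ht1 hD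
  have hU := le_of_hasSum_affine hw hppos hmpos h0 h1 ht0.le ht1 hD
  set D := genFun f 1 - genFun f (1 - t)
  have hLpos : 0 < m ^ 2 * t / (m + t * B) := by positivity
  have hDpos : 0 < D := hLpos.trans_le hL
  refine ⟨hDpos, ?_, ?_⟩
  · refine (one_div_le_one_div_of_le hLpos hL).trans ?_
    have e : 1 / (m ^ 2 * t / (m + t * B)) = 1 / (m * t) + B / m ^ 2 := by field_simp
    rw [e]
    have : B / m ^ 2 ≤ 2 * c * (1 / p - 1 / m) := by
      rw [div_le_iff₀ (by positivity)]
      refine hBr.trans (le_of_eq ?_)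
      field_simp
    linarith
  · refine le_trans (le_of_eq ?_) (one_div_le_one_div_of_le hDpos hU)
    field_simp
    ring

end Weights

/-! ### Comparison of survival and Laplace transform along compositions -/

section Iterates

/-- The composition `f_{n+1} ∘ ⋯ ∘ f_{n+k}` of generating functions. -/
noncomputable def iterGen (f : ℕ → PMF NatDelta) : ℕ → ℕ → ℝ → ℝ
  | _, 0, s => s
  | n, k + 1, s => genFun (f n) (iterGen f (n + 1) k s)

variable (f : ℕ → PMF NatDelta)

theorem iterGen_mem (n k : ℕ) {s : ℝ} (hs : s ∈ Set.Icc (0 : ℝ) 1) :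
    iterGen f n k s ∈ Set.Icc (0 : ℝ) 1 := by
  induction k generalizing n with
  | zero => exact hs
  | succ k ih => exact genFun_mem _ (ih (n + 1))

theorem iterGen_mono (n k : ℕ) {s s' : ℝ} (h0 : 0 ≤ s) (h : s ≤ s') (h1 : s' ≤ 1) :
    iterGen f n k s ≤ iterGen f n k s' := by
  induction k generalizing n with
  | zero => exact h
  | succ k ih =>
    exact genFun_mono _ (iterGen_mem f _ _ ⟨h0, h.trans h1⟩).1 (ih (n + 1))
      (iterGen_mem f _ _ ⟨h0.trans h, h1⟩).2

variable {f}

/-- This is `1 / x ≤ K / y + r / q` with denominators cleared, so that `y = 0` is allowed. The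
outermost generating function is peeled off: it divides both reciprocals by its mean and adds an
error, and the term `r / q` is merely rescaled. -/
theorem iterGen_sub_le_mul {c K : ℝ} (hK : 1 ≤ K) (hcK : 4 * c ≤ K)
    (hpos : ∀ n, 0 < derivOne (f n)) (hfin : ∀ n, derivOne (f n) < ∞)
    (hc : 0 < c) (hcond : ∀ n, truncMoment (f n) 2 2 ≤
      ENNReal.ofReal c * truncMoment (f n) 1 2 * condMean (f n))
    {s : ℝ} (hs0 : 0 ≤ s) (hs1 : s < 1) (n k : ℕ) :
    iterGen f n k 1 - iterGen f n k 0 ≤ (1 - iterGen f n k s) *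
      (K + (1 / (1 - s) - 1) / (∏ i ∈ Finset.range k, (derivOne (f (n + i))).toReal) *
        (iterGen f n k 1 - iterGen f n k 0)) := by
  have hr : 0 ≤ 1 / (1 - s) - 1 := by
    rw [sub_nonneg, le_div_iff₀ (by linarith)]
    linarith
  set r := 1 / (1 - s) - 1 with hrdef
  induction k generalizing n with
  | zero =>
    have h1s : 0 < 1 - s := by linarith
    have e : (1 - s) * r = s := by
      rw [hrdef]; field_simp; ring
    simp only [iterGen, Finset.range_zero, Finset.prod_empty]
    nlinarith
  | succ k ih =>
    specialize ih (n + 1)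
    have hprod : ∏ i ∈ Finset.range (k + 1), (derivOne (f (n + i))).toReal
        = (∏ i ∈ Finset.range k, (derivOne (f (n + 1 + i))).toReal) * (derivOne (f n)).toReal := by
      rw [Finset.prod_range_succ']
      simp [add_comm, add_left_comm]
    have hmpos : ∀ n, 0 < (derivOne (f n)).toReal :=
      fun n => ENNReal.toReal_pos (hpos n).ne' (hfin n).ne
    have hqpos : 0 < ∏ i ∈ Finset.range k, (derivOne (f (n + 1 + i))).toReal :=
      Finset.prod_pos fun i _ => hmpos _
    rw [hprod]
    have hm := hmpos n
    set q := ∏ i ∈ Finset.range k, (derivOne (f (n + 1 + i))).toReal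
    set m := (derivOne (f n)).toReal
    have ha := iterGen_mem f (n + 1) k (s := 1) (by simp)
    have hb := iterGen_mem f (n + 1) k (s := 0) (by simp)
    have hu := iterGen_mem f (n + 1) k (s := s) ⟨hs0, hs1.le⟩
    have hba := iterGen_mono f (n + 1) k le_rfl zero_le_one le_rfl
    simp only [iterGen]
    set a := iterGen f (n + 1) k 1
    set b := iterGen f (n + 1) k 0
    set u := iterGen f (n + 1) k s
    have hy0 : 0 ≤ genFun (f n) a - genFun (f n) b :=
      sub_nonneg.2 (genFun_mono _ hb.1 hba ha.2)
    -- Both reductions to increments at `1` go the favourable way: `y` is bounded above, and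
    -- dropping the defect `1 - f 1` bounds `x` below.
    have hyD := genFun_sub_le (f n) hb.1 hba ha.2
    have hxD : genFun (f n) 1 - genFun (f n) (1 - (1 - u)) ≤ 1 - genFun (f n) u := by
      rw [sub_sub_cancel]
      linarith [genFun_one_le_one (f n)]
    have hx0 : 0 ≤ 1 - genFun (f n) u := sub_nonneg.2 (genFun_mem (f n) hu).2
    rcases hy0.eq_or_lt with hy | hy
    · rw [← hy]
      nlinarith
    obtain ⟨φ, hφ, hshape⟩ := exists_shape_bounds (hpos n) (hfin n) hc (hcond n)
    have hy' : 0 < a - b := by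
      rcases (sub_nonneg.2 hba).eq_or_lt with h | h
      · rw [← h] at hyD
        simp only [sub_zero, sub_self] at hyD
        linarith
      · exact h
    have hRy : 0 ≤ r / q * (a - b) := by positivity
    have hx' : 0 < 1 - u := by
      by_contra h
      have : (1 - u) * (K + r / q * (a - b)) ≤ 0 :=
        mul_nonpos_of_nonpos_of_nonneg (not_lt.1 h) (by linarith)
      linarith
    obtain ⟨hDx, hUx, -⟩ := hshape (1 - u) hx' (by linarith [hu.1])
    obtain ⟨hDy, -, hLy⟩ := hshape (a - b) hy' (by linarith [ha.2, hb.1])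
    set Dx := genFun (f n) 1 - genFun (f n) (1 - (1 - u))
    set Dy := genFun (f n) 1 - genFun (f n) (1 - (a - b))
    have hx : 0 < 1 - genFun (f n) u := hDx.trans_le hxD
    have h1 : 1 / (1 - u) ≤ K / (a - b) + r / q := by
      rw [div_le_iff₀ hx']
      have e : (K / (a - b) + r / q) * (1 - u)
          = ((1 - u) * (K + r / q * (a - b))) / (a - b) := by
        rw [eq_div_iff hy'.ne', mul_assoc, mul_comm (1 - u), ← mul_assoc, add_mul,
          div_mul_cancel₀ _ hy'.ne', mul_comm]
      rw [e, le_div_iff₀ hy', one_mul]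
      exact ih
    have h2 : 1 / (m * (1 - u)) ≤ K * (1 / (m * (a - b))) + r / (q * m) := by
      have e1 : 1 / (m * (1 - u)) = 1 / (1 - u) / m := by rw [div_div, mul_comm]
      have e2 : K * (1 / (m * (a - b))) + r / (q * m) = (K / (a - b) + r / q) / m := by
        rw [add_div, div_div, div_div, mul_comm (a - b), mul_one_div]
      rw [e1, e2]
      gcongr
    -- Here `4 c ≤ K` lets the error of `1 / x` be absorbed by `K` times that of `1 / y`.
    have h3 : 2 * c * φ ≤ K * (φ / 2) := by nlinarith
    have h4 : K * (1 / (m * (a - b)) + φ / 2) ≤ K * (1 / Dy) :=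
      mul_le_mul_of_nonneg_left hLy (by linarith)
    have h5 : K * (1 / Dy) ≤ K * (1 / (genFun (f n) a - genFun (f n) b)) :=
      mul_le_mul_of_nonneg_left (one_div_le_one_div_of_le hy hyD) (by linarith)
    have h6 := one_div_le_one_div_of_le hDx hxD
    set x := 1 - genFun (f n) u
    set y := genFun (f n) a - genFun (f n) b
    have h7 : 1 / x ≤ K * (1 / y) + r / (q * m) := by linarith
    rw [div_le_iff₀ hx] at h7
    have h8 := mul_le_mul_of_nonneg_right h7 hy.le
    have e : (K * (1 / y) + r / (q * m)) * x * y = x * (K * (1 / y * y) + r / (q * m) * y) := by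
      ring
    rw [e, one_div_mul_cancel hy.ne'] at h8
    linarith

theorem mu_pos (hpos : ∀ n, 0 < derivOne (f n)) (hfin : ∀ n, derivOne (f n) < ∞) (n : ℕ) :
    0 < mu f n :=
  Finset.prod_pos fun i _ => ENNReal.toReal_pos (hpos i).ne' (hfin i).ne

theorem iterGen_sub_le {c K : ℝ} (hK : 1 ≤ K) (hcK : 4 * c ≤ K)
    (hpos : ∀ n, 0 < derivOne (f n)) (hfin : ∀ n, derivOne (f n) < ∞)
    (hc : 0 < c) (hcond : ∀ n, truncMoment (f n) 2 2 ≤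
      ENNReal.ofReal c * truncMoment (f n) 1 2 * condMean (f n)) (n k : ℕ) :
    1 / (K + 1) * (iterGen f n k 1 - iterGen f n k 0) ≤
      1 - iterGen f n k (Real.exp (-(mu f n / mu f (n + k)))) := by
  have hμ := mu_pos hpos hfin
  have hq : mu f (n + k) = mu f n * ∏ i ∈ Finset.range k, (derivOne (f (n + i))).toReal :=
    Finset.prod_range_add _ _ _
  set s := Real.exp (-(mu f n / mu f (n + k))) with hs
  have hdiv : 0 < mu f n / mu f (n + k) := div_pos (hμ _) (hμ _)
  have hs1 : s < 1 := by rw [hs, Real.exp_lt_one_iff]; linarith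
  have h := iterGen_sub_le_mul hK hcK hpos hfin hc hcond (Real.exp_pos _).le hs1 n k
  set q := ∏ i ∈ Finset.range k, (derivOne (f (n + i))).toReal
  have hqpos : 0 < q := Finset.prod_pos fun i _ => ENNReal.toReal_pos (hpos _).ne' (hfin _).ne
  have hsq : s = Real.exp (-(1 / q)) := by
    rw [hs, hq, div_mul_cancel_left₀ (hμ n).ne', one_div]
  -- Since `s = exp(-1/q)`, the numerator is `1 / (exp(1/q) - 1)`, at most `q`.
  have hr : (1 / (1 - s) - 1) / q ≤ 1 := by
    rw [div_le_one hqpos, sub_le_iff_le_add, div_le_iff₀ (by linarith)]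
    have h1 : 1 / q + 1 ≤ Real.exp (1 / q) := Real.add_one_le_exp _
    have h2 : s * Real.exp (1 / q) = 1 := by rw [hsq, ← Real.exp_add]; simp
    have h3 : s * (1 / q + 1) ≤ 1 := (mul_le_mul_of_nonneg_left h1 (Real.exp_pos _).le).trans_eq h2
    have h4 : s * (1 + q) ≤ q := by
      have := mul_le_mul_of_nonneg_right h3 hqpos.le
      have e : s * (1 / q + 1) * q = s * (1 + q) := by field_simp
      linarith
    linarith
  have ha := iterGen_mem f n k (s := 1) (by simp)
  have hb := iterGen_mem f n k (s := 0) (by simp)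
  have hu := iterGen_mem f n k (s := s) ⟨(Real.exp_pos _).le, hs1.le⟩
  have hba := iterGen_mono f n k le_rfl zero_le_one le_rfl
  have h5 : (1 / (1 - s) - 1) / q * (iterGen f n k 1 - iterGen f n k 0) ≤ 1 := by
    have := mul_le_mul_of_nonneg_right hr (sub_nonneg.2 hba)
    linarith [ha.2, hb.1]
  have h6 := h.trans (mul_le_mul_of_nonneg_left (add_le_add_right h5 K) (sub_nonneg.2 hu.2))
  rw [one_div_mul_eq_div, div_le_iff₀ (by linarith)]
  exact h6

end Iterates

/-! ### Powers with exponent in `ℕ₀ ∪ {Δ}` -/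

section Pow

/-- `s ^ z` with the convention `s ^ Δ = 0`. -/
noncomputable def powDelta (s : ℝ) (z : NatDelta) : ℝ :=
  open Classical in if z = grave then 0 else s ^ z.toNat

@[simp]
theorem powDelta_grave (s : ℝ) : powDelta s grave = 0 := by simp [powDelta]

@[simp]
theorem powDelta_coe (s : ℝ) (k : ℕ) : powDelta s k = s ^ k := by simp [powDelta]

theorem powDelta_mem {s : ℝ} (hs : s ∈ Set.Icc (0 : ℝ) 1) (z : NatDelta) :
    powDelta s z ∈ Set.Icc (0 : ℝ) 1 := by
  induction z using ENat.recTopCoe with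
  | top => simp
  | coe k => rw [powDelta_coe]; exact ⟨pow_nonneg hs.1 k, pow_le_one₀ hs.1 hs.2⟩

theorem powDelta_add (s : ℝ) (y z : NatDelta) :
    powDelta s (y + z) = powDelta s y * powDelta s z := by
  induction y using ENat.recTopCoe with
  | top => simp
  | coe j =>
    induction z using ENat.recTopCoe with
    | top => simp
    | coe k => rw [← Nat.cast_add, powDelta_coe, powDelta_coe, powDelta_coe, pow_add]

theorem powDelta_sum {ι : Type*} (s : ℝ) (S : Finset ι) (x : ι → NatDelta) :
    powDelta s (∑ i ∈ S, x i) = ∏ i ∈ S, powDelta s (x i) := by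
  classical
  induction S using Finset.induction_on with
  | empty => simpa using powDelta_coe s 0
  | insert i S hi ih => rw [Finset.sum_insert hi, Finset.prod_insert hi, powDelta_add, ih]

/-- Passes from one ancestor to `k` independent ones. In the induction, `1 - u ^ (k + 1)` is bounded
below by `p + q - p q` with `p = c₀ (a - b)` and `q = c₀ (a ^ k - b ^ k)`. -/
theorem mul_pow_sub_pow_le {a b u c₀ : ℝ} (hb : 0 ≤ b) (hba : b ≤ a) (ha : a ≤ 1)
    (hu0 : 0 ≤ u) (hc0 : 0 ≤ c₀) (hc1 : c₀ ≤ 1) (h : c₀ * (a - b) ≤ 1 - u) (k : ℕ) :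
    c₀ * (a ^ k - b ^ k) ≤ 1 - u ^ k := by
  induction k with
  | zero => simp
  | succ k ih =>
    have hbk : 0 ≤ b ^ k := pow_nonneg hb k
    have hbak : b ^ k ≤ a ^ k := pow_le_pow_left₀ hb hba k
    have hak : a ^ k ≤ 1 := pow_le_one₀ (hb.trans hba) ha
    have huk : 0 ≤ u ^ k := pow_nonneg hu0 k
    have hy : 0 ≤ a - b := sub_nonneg.2 hba
    have hD : 0 ≤ a ^ k - b ^ k := sub_nonneg.2 hbak
    have h1 : u ^ k * (c₀ * (a - b)) ≤ u ^ k * (1 - u) := mul_le_mul_of_nonneg_left h huk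
    have hcy : c₀ * (a - b) ≤ 1 := by nlinarith
    have h2 : (1 - c₀ * (a - b)) * (c₀ * (a ^ k - b ^ k)) ≤ (1 - c₀ * (a - b)) * (1 - u ^ k) :=
      mul_le_mul_of_nonneg_left ih (by linarith)
    have h3 : 0 ≤ (a ^ k - b ^ k) * (1 - a) := mul_nonneg hD (by linarith)
    have h4 : c₀ * (a ^ k - b ^ k) ≤ a ^ k - b ^ k := mul_le_of_le_one_left hD hc1
    have h5 : 0 ≤ (1 - c₀ * (a ^ k - b ^ k) - b ^ k) * (a - b) := mul_nonneg (by linarith) hy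
    have h6 := mul_nonneg hc0 (add_nonneg h3 h5)
    rw [pow_succ, pow_succ, pow_succ]
    nlinarith

theorem mul_powDelta_sub_le {a b u c₀ : ℝ} (hb : 0 ≤ b) (hba : b ≤ a) (ha : a ≤ 1)
    (hu0 : 0 ≤ u) (hc0 : 0 ≤ c₀) (hc1 : c₀ ≤ 1) (h : c₀ * (a - b) ≤ 1 - u)
    (z : NatDelta) : c₀ * (powDelta a z - powDelta b z) ≤ 1 - powDelta u z := by
  induction z using ENat.recTopCoe with
  | top => simp
  | coe k => simpa using mul_pow_sub_pow_le hb hba ha hu0 hc0 hc1 h k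

end Pow

/-! ### Freezing a countably-valued variable under independence -/

section Indep

variable {Ω ι : Type*} {mΩ : MeasurableSpace Ω} [Countable ι] [MeasurableSpace ι]
  [MeasurableSingletonClass ι]

theorem measurable_eval_of_countable {β : Type*} [MeasurableSpace β] {ζ : Ω → ι}
    (hζ : Measurable ζ) {G : ι → Ω → β} (hG : ∀ z, Measurable (G z)) :
    Measurable fun ω => G (ζ ω) ω := by
  intro B hB
  have : (fun ω => G (ζ ω) ω) ⁻¹' B = ⋃ z, ζ ⁻¹' {z} ∩ G z ⁻¹' B := by
    ext ω; simp
  rw [this]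
  exact MeasurableSet.iUnion fun z => (hζ (measurableSet_singleton z)).inter (hG z hB)

theorem setLIntegral_eval_eq_tsum {P : Measure Ω} {A : Set Ω} (hA : MeasurableSet A) {ζ : Ω → ι}
    (hζ : Measurable ζ) (G : ι → Ω → ℝ≥0∞) :
    ∫⁻ ω in A, G (ζ ω) ω ∂P = ∑' z, ∫⁻ ω in A ∩ ζ ⁻¹' {z}, G z ω ∂P := by
  have hB : ∀ z, MeasurableSet (A ∩ ζ ⁻¹' {z}) := fun z => hA.inter (hζ (measurableSet_singleton z))
  have hU : A = ⋃ z, A ∩ ζ ⁻¹' {z} := by ext ω; simp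
  conv_lhs => rw [hU]
  rw [lintegral_iUnion hB]
  · refine tsum_congr fun z => setLIntegral_congr_fun (hB z) fun ω hω => ?_
    have : ζ ω = z := hω.2
    simp only [this]
  · intro y z hyz
    refine Set.disjoint_left.2 fun ω hy hz => hyz ?_
    exact (show ζ ω = y from hy.2).symm.trans (show ζ ω = z from hz.2)

/-- On each of the countably many events `ζ = z` the integrand is `G z`, independent of `M₁`, so the
integral factorizes. -/
theorem setLIntegral_eval_of_indep {Ω : Type*} {M₁ M₂ mΩ : MeasurableSpace Ω} {P : Measure Ω}
    (h₁ : M₁ ≤ mΩ) (h₂ : M₂ ≤ mΩ) (hind : Indep M₁ M₂ P) {A : Set Ω} (hA : MeasurableSet[M₁] A) {ζ : Ω → ι}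
    (hζ : Measurable[M₁] ζ) {G : ι → Ω → ℝ≥0∞} (hG : ∀ z, Measurable[M₂] (G z)) :
    ∫⁻ ω in A, G (ζ ω) ω ∂P = ∫⁻ ω in A, ∫⁻ ω', G (ζ ω) ω' ∂P ∂P := by
  have hζ' : Measurable ζ := hζ.mono h₁ le_rfl
  rw [setLIntegral_eval_eq_tsum (h₁ _ hA) hζ',
    setLIntegral_eval_eq_tsum (h₁ _ hA) hζ' fun z _ => ∫⁻ ω', G z ω' ∂P]
  refine tsum_congr fun z => ?_
  have hB : MeasurableSet[M₁] (A ∩ ζ ⁻¹' {z}) :=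
    @MeasurableSet.inter Ω M₁ _ _ hA (hζ (measurableSet_singleton z))
  have hm : Measurable[M₁] ((A ∩ ζ ⁻¹' {z}).indicator fun _ => (1 : ℝ≥0∞)) :=
    (@measurable_const _ _ _ M₁ _).indicator hB
  rw [setLIntegral_const, ← lintegral_indicator (h₁ _ hB)]
  have := lintegral_mul_eq_lintegral_mul_lintegral_of_independent_measurableSpace h₁ h₂ hind
    hm (hG z)
  rw [lintegral_indicator_const (h₁ _ hB), one_mul] at this
  rw [mul_comm, ← this]
  refine lintegral_congr fun ω => ?_
  by_cases h : ω ∈ A ∩ ζ ⁻¹' {z} <;> simp [h]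

end Indep

/-! ### σ-algebras generated by generations -/

section Algebra

variable {Ω : Type*} {X : ℕ → ℕ → Ω → NatDelta}

theorem sumTo_grave (x : ℕ → NatDelta) : sumTo x grave = grave := by simp [sumTo]

theorem sumTo_coe (x : ℕ → NatDelta) (k : ℕ) : sumTo x k = ∑ j ∈ Finset.range k, x j := by
  simp [sumTo]

/-- The σ-algebra generated by the offspring numbers with generation index in `I`. -/
@[reducible]
def offspringAlg (X : ℕ → ℕ → Ω → NatDelta) (I : Set ℕ) : MeasurableSpace Ω :=
  ⨆ i ∈ {i : ℕ × ℕ | i.1 ∈ I}, MeasurableSpace.comap (X i.1 i.2) inferInstance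

theorem measurable_offspringAlg {I : Set ℕ} {n : ℕ} (hn : n ∈ I) (j : ℕ) :
    Measurable[offspringAlg X I] (X n j) := by
  refine Measurable.mono (comap_measurable (X n j)) ?_ le_rfl
  exact le_iSup₂_of_le (f := fun (i : ℕ × ℕ) (_ : i ∈ {i : ℕ × ℕ | i.1 ∈ I}) =>
    MeasurableSpace.comap (X i.1 i.2) inferInstance) (n, j) hn le_rfl

theorem offspringAlg_mono {I J : Set ℕ} (h : I ⊆ J) : offspringAlg X I ≤ offspringAlg X J :=
  biSup_mono fun _ hi => h hi

theorem measurable_sumTo {m : MeasurableSpace Ω} {x : ℕ → Ω → NatDelta} (hx : ∀ j, Measurable (x j))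
    (z : NatDelta) : Measurable fun ω => sumTo (fun j => x j ω) z := by
  induction z using ENat.recTopCoe with
  | top => simp only [sumTo_grave, measurable_const]
  | coe k =>
    simp only [sumTo_coe]
    exact Finset.measurable_fun_sum _ fun j _ => hx j

theorem measurable_Z (n : ℕ) : Measurable[offspringAlg X (Set.Iio n)] (Z X n) := by
  induction n with
  | zero => exact measurable_const
  | succ n ih =>
    let _ := offspringAlg X (Set.Iio (n + 1))
    have h1 : Measurable (Z X n) :=
      Measurable.mono ih (offspringAlg_mono (Set.Iio_subset_Iio n.le_succ)) le_rfl
    exact measurable_eval_of_countable h1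
      (measurable_sumTo fun j => measurable_offspringAlg (Set.mem_Iio.2 n.lt_succ_self) j)

end Algebra

/-! ### One-step transitions -/

section OneStep

variable {Ω : Type*} [mΩ : MeasurableSpace Ω] {P : Measure Ω}
  {f : ℕ → PMF NatDelta} {X : ℕ → ℕ → Ω → NatDelta}

theorem offspringAlg_le (hX : ∀ n j, Measurable (X n j)) (I : Set ℕ) : offspringAlg X I ≤ mΩ :=
  iSup₂_le fun i _ => (hX i.1 i.2).comap_le

theorem indep_offspringAlg (hX : IsOffspringFamily P f X) {I J : Set ℕ} (h : Disjoint I J) :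
    Indep (offspringAlg X I) (offspringAlg X J) P :=
  indep_iSup_of_disjoint (m := fun i : ℕ × ℕ => MeasurableSpace.comap (X i.1 i.2) inferInstance)
    (fun i => (hX.measurable i.1 i.2).comap_le) hX.indep.iIndep
    (Set.disjoint_left.2 fun _ h1 h2 => Set.disjoint_left.1 h h1 h2)

/-- The filtration generated by the offspring numbers of the past generations. -/
def offspringFiltration (hX : ∀ n j, Measurable (X n j)) : Filtration ℕ mΩ where
  seq n := offspringAlg X (Set.Iio n)
  mono' _ _ h := offspringAlg_mono (Set.Iio_subset_Iio h)
  le' _ := offspringAlg_le hX _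

/-- The Markov property: generation `n` of the offspring numbers is independent of the earlier ones,
which determine `A` and `Z X n`. -/
theorem setLIntegral_Z_succ (hX : IsOffspringFamily P f X) (φ : NatDelta → ℝ≥0∞) (n : ℕ) {A : Set Ω}
    (hA : MeasurableSet[offspringAlg X (Set.Iio n)] A) :
    ∫⁻ ω in A, φ (Z X (n + 1) ω) ∂P
      = ∫⁻ ω in A, ∫⁻ ω', φ (sumTo (fun j => X n j ω') (Z X n ω)) ∂P ∂P := by
  have hind : Indep (offspringAlg X (Set.Iio n)) (offspringAlg X {n}) P :=
    indep_offspringAlg hX (by simp)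
  have hG : ∀ z, Measurable[offspringAlg X {n}] fun ω => φ (sumTo (fun j => X n j ω) z) :=
    fun z => (measurable_of_countable φ).comp
      (measurable_sumTo (m := offspringAlg X {n})
        (fun j => measurable_offspringAlg (Set.mem_singleton n) j) z)
  simp only [Z]
  exact setLIntegral_eval_of_indep (offspringAlg_le hX.measurable _)
    (offspringAlg_le hX.measurable _) hind hA (measurable_Z n) hG

theorem lintegral_offspring (hX : IsOffspringFamily P f X) (φ : NatDelta → ℝ≥0∞)
    (hφ : φ grave = 0) (n j : ℕ) :
    ∫⁻ ω, φ (X n j ω) ∂P = ∑' k : ℕ, φ k * f n k := by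
  rw [← lintegral_map (measurable_of_countable φ) (hX.measurable n j), lintegral_countable']
  have : ∀ z, P.map (X n j) {z} = f n z := fun z => by
    rw [Measure.map_apply (hX.measurable n j) (measurableSet_singleton z), ← hX.law n j z]
    rfl
  simp only [this]
  refine (Function.Injective.tsum_eq (g := fun k : ℕ => (k : NatDelta))
    (f := fun z => φ z * f n z) (fun a b h => by simpa using h) fun z hz => ?_).symm
  induction z using ENat.recTopCoe with
  | top => simp [hφ] at hz
  | coe k => exact ⟨k, rfl⟩

theorem lintegral_powDelta_sumTo (hX : IsOffspringFamily P f X) {s : ℝ}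
    (hs : s ∈ Set.Icc (0 : ℝ) 1) (n : ℕ) (z : NatDelta) :
    ∫⁻ ω, ENNReal.ofReal (powDelta s (sumTo (fun j => X n j ω) z)) ∂P
      = ENNReal.ofReal (powDelta (genFun (f n) s) z) := by
  induction z using ENat.recTopCoe with
  | top => simp [sumTo_grave]
  | coe k =>
    have h1 : ∀ j, ∫⁻ ω, ENNReal.ofReal (powDelta s (X n j ω)) ∂P
        = ENNReal.ofReal (genFun (f n) s) := fun j => by
      rw [lintegral_offspring hX (fun z => ENNReal.ofReal (powDelta s z)) (by simp), genFun,
        ENNReal.ofReal_tsum_of_nonneg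
          (fun k => mul_nonneg ENNReal.toReal_nonneg (pow_nonneg hs.1 k))
          (summable_weight_mul_pow (f n) hs.1 hs.2)]
      refine tsum_congr fun k => ?_
      rw [powDelta_coe, mul_comm, ENNReal.ofReal_mul ENNReal.toReal_nonneg,
        ENNReal.ofReal_toReal ((f n).apply_ne_top _)]
    have hi : iIndepFun (fun j ω => ENNReal.ofReal (powDelta s (X n j ω))) P :=
      (hX.indep.precomp (g := fun j : ℕ => (n, j)) fun a b h => by simpa using h).comp
        (fun _ z => ENNReal.ofReal (powDelta s z)) fun _ => measurable_of_countable _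
    have hm : ∀ j, Measurable fun ω => ENNReal.ofReal (powDelta s (X n j ω)) := fun j =>
      (measurable_of_countable fun z => ENNReal.ofReal (powDelta s z)).comp (hX.measurable n j)
    simp only [sumTo_coe, powDelta_sum, powDelta_coe]
    simp only [ENNReal.ofReal_prod_of_nonneg fun j _ => (powDelta_mem hs _).1]
    rw [lintegral_prod_eq_prod_lintegral_of_indepFun _ _ hi hm]
    simp only [h1, Finset.prod_const, Finset.card_range]
    rw [ENNReal.ofReal_pow (genFun_nonneg _ hs.1)]

theorem toNat_sum_le {ι : Type*} (S : Finset ι) (x : ι → NatDelta) :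
    (∑ i ∈ S, x i).toNat ≤ ∑ i ∈ S, (x i).toNat := by
  classical
  induction S using Finset.induction_on with
  | empty => simp
  | insert i S hi ih =>
    rw [Finset.sum_insert hi, Finset.sum_insert hi]
    refine le_trans ?_ (Nat.add_le_add_left ih _)
    generalize ∑ i ∈ S, x i = y
    generalize x i = z
    induction y using ENat.recTopCoe with
    | top => simp
    | coe j =>
      induction z using ENat.recTopCoe with
      | top => simp
      | coe k => rw [← Nat.cast_add, ENat.toNat_natCast, ENat.toNat_natCast, ENat.toNat_natCast]

/-- Only an inequality: `toNat` sends `Δ` to `0`, so a single `Δ` among the summands wipes out the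
total. -/
theorem lintegral_toNat_sumTo_le (hX : IsOffspringFamily P f X) (n : ℕ) (z : NatDelta) :
    ∫⁻ ω, ((sumTo (fun j => X n j ω) z).toNat : ℝ≥0∞) ∂P ≤ derivOne (f n) * z.toNat := by
  induction z using ENat.recTopCoe with
  | top => simp [sumTo_grave]
  | coe k =>
    simp only [sumTo_coe]
    have hm : ∀ j, Measurable fun ω => ((X n j ω).toNat : ℝ≥0∞) := fun j =>
      (measurable_of_countable fun z : NatDelta => (z.toNat : ℝ≥0∞)).comp (hX.measurable n j)
    refine le_of_le_of_eq (b := ∑ j ∈ Finset.range k, derivOne (f n)) ?_ (by simp [mul_comm])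
    calc ∫⁻ ω, ((∑ j ∈ Finset.range k, X n j ω).toNat : ℝ≥0∞) ∂P
        ≤ ∫⁻ ω, ∑ j ∈ Finset.range k, ((X n j ω).toNat : ℝ≥0∞) ∂P :=
          lintegral_mono fun ω =>
            (Nat.cast_le.2 (toNat_sum_le _ _)).trans_eq (Nat.cast_sum _ _)
      _ = ∑ j ∈ Finset.range k, ∫⁻ ω, ((X n j ω).toNat : ℝ≥0∞) ∂P :=
          lintegral_finsetSum _ fun j _ => hm j
      _ = ∑ j ∈ Finset.range k, derivOne (f n) := by
          refine Finset.sum_congr rfl fun j _ => ?_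
          rw [lintegral_offspring hX (fun z => (z.toNat : ℝ≥0∞)) (by simp)]
          simp [derivOne]

end OneStep

/-! ### Normalized process and survival event -/

section Pathwise

variable {Ω : Type*} {f : ℕ → PMF NatDelta} {X : ℕ → ℕ → Ω → NatDelta}

/-- The normalized process `Zₙ / μₙ`, set to `0` in the graveyard. -/
noncomputable def normZ (f : ℕ → PMF NatDelta) (X : ℕ → ℕ → Ω → NatDelta) (n : ℕ) (ω : Ω) : ℝ :=
  ((Z X n ω).toNat : ℝ) / mu f n

theorem normZ_nonneg (n : ℕ) (ω : Ω) : 0 ≤ normZ f X n ω :=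
  div_nonneg (Nat.cast_nonneg _) (Finset.prod_nonneg fun _ _ => ENNReal.toReal_nonneg)

theorem powDelta_exp_neg_div (lam : ℝ) (n : ℕ) {ω : Ω} (hω : Z X n ω ≠ grave) :
    powDelta (Real.exp (-(lam / mu f n))) (Z X n ω) = Real.exp (-(lam * normZ f X n ω)) := by
  rw [powDelta, if_neg hω, ← Real.exp_nat_mul, normZ]
  congr 1
  ring

/-- The event that neither `0` nor `Δ` is ever visited. -/
def aliveSet (X : ℕ → ℕ → Ω → NatDelta) : Set Ω :=
  {ω | ∀ n, Z X n ω ≠ 0 ∧ Z X n ω ≠ grave}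

theorem mem_aliveSet_of_tauA {ω : Ω} (h : tauA X ω = ⊤) : ω ∈ aliveSet X := by
  have key : ∀ {z : NatDelta}, hitTime X z ω = ⊤ → ∀ n, 1 ≤ n → Z X n ω ≠ z := by
    intro z hz n hn h
    have : hitTime X z ω ≤ n := iInf₂_le n ⟨hn, h⟩
    rw [hz, top_le_iff] at this
    exact ENat.natCast_ne_top n this
  obtain ⟨h0, hΔ⟩ := min_eq_top.1 h
  intro n
  -- Hitting times only look at `n ≥ 1`; at time `0` the state is `1`.
  rcases n with _ | n
  · exact ⟨one_ne_zero, ENat.natCast_ne_top 1⟩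
  · exact ⟨key h0 _ n.succ_pos, key hΔ _ n.succ_pos⟩

/-- With `0 ^ 0 = 1` and `s ^ Δ = 0`, the difference `1 ^ z - 0 ^ z` is the indicator of `z ∉ {0,
Δ}`, so generating functions at `1` and `0` encode survival. -/
theorem powDelta_one_sub_zero (z : NatDelta) (h0 : z ≠ 0) (hΔ : z ≠ grave) :
    powDelta 1 z - powDelta 0 z = 1 := by
  induction z using ENat.recTopCoe with
  | top => exact absurd rfl hΔ
  | coe k =>
    have : k ≠ 0 := by simpa using h0
    simp [this]

theorem powDelta_one_sub_zero_nonneg (z : NatDelta) : 0 ≤ powDelta 1 z - powDelta 0 z := by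
  induction z using ENat.recTopCoe with
  | top => simp
  | coe k => simpa using pow_le_one₀ (n := k) le_rfl (zero_le_one' ℝ)

end Pathwise

/-! ### Almost sure limit and its positivity on survival -/

section Limit

variable {Ω : Type*} [mΩ : MeasurableSpace Ω] {P : Measure Ω}
  {f : ℕ → PMF NatDelta} {X : ℕ → ℕ → Ω → NatDelta}

theorem measurable_comp_Z (hX : IsOffspringFamily P f X) {β : Type*} [MeasurableSpace β]
    (φ : NatDelta → β) (n : ℕ) : Measurable fun ω => φ (Z X n ω) :=
  (measurable_of_countable φ).comp
    ((measurable_Z n).mono (offspringAlg_le hX.measurable _) le_rfl)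

theorem setIntegral_powDelta_Z_succ (hX : IsOffspringFamily P f X) {s : ℝ}
    (hs : s ∈ Set.Icc (0 : ℝ) 1) (n : ℕ) {A : Set Ω}
    (hA : MeasurableSet[offspringAlg X (Set.Iio n)] A) :
    ∫ ω in A, powDelta s (Z X (n + 1) ω) ∂P
      = ∫ ω in A, powDelta (genFun (f n) s) (Z X n ω) ∂P := by
  rw [integral_eq_lintegral_of_nonneg_ae (Eventually.of_forall fun ω => (powDelta_mem hs _).1)
      (measurable_comp_Z hX (powDelta s) (n + 1)).aestronglyMeasurable,
    integral_eq_lintegral_of_nonneg_ae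
      (Eventually.of_forall fun ω => (powDelta_mem (genFun_mem (f n) hs) _).1)
      (measurable_comp_Z hX (powDelta (genFun (f n) s)) n).aestronglyMeasurable,
    setLIntegral_Z_succ hX (fun z => ENNReal.ofReal (powDelta s z)) n hA]
  simp only [lintegral_powDelta_sumTo hX hs]

theorem setIntegral_powDelta_Z_add (hX : IsOffspringFamily P f X) {s : ℝ}
    (hs : s ∈ Set.Icc (0 : ℝ) 1) (n k : ℕ) {A : Set Ω}
    (hA : MeasurableSet[offspringAlg X (Set.Iio n)] A) :
    ∫ ω in A, powDelta s (Z X (n + k) ω) ∂P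
      = ∫ ω in A, powDelta (iterGen f n k s) (Z X n ω) ∂P := by
  induction k generalizing n with
  | zero => rfl
  | succ k ih =>
    have hA' : MeasurableSet[offspringAlg X (Set.Iio (n + 1))] A :=
      offspringAlg_mono (Set.Iio_subset_Iio n.le_succ) A hA
    rw [show n + (k + 1) = n + 1 + k by ring, ih (n + 1) hA',
      setIntegral_powDelta_Z_succ hX (iterGen_mem f _ _ hs) n hA]
    rfl

theorem setLIntegral_toNat_Z_succ_le (hX : IsOffspringFamily P f X) (n : ℕ) {A : Set Ω}
    (hA : MeasurableSet[offspringAlg X (Set.Iio n)] A) :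
    ∫⁻ ω in A, ((Z X (n + 1) ω).toNat : ℝ≥0∞) ∂P
      ≤ derivOne (f n) * ∫⁻ ω in A, ((Z X n ω).toNat : ℝ≥0∞) ∂P := by
  rw [setLIntegral_Z_succ hX (fun z => (z.toNat : ℝ≥0∞)) n hA,
    ← lintegral_const_mul _ (measurable_comp_Z hX (fun z => (z.toNat : ℝ≥0∞)) n)]
  exact lintegral_mono fun ω => lintegral_toNat_sumTo_le hX n _

theorem lintegral_toNat_Z_le [IsProbabilityMeasure P] (hX : IsOffspringFamily P f X) (n : ℕ) :
    ∫⁻ ω, ((Z X n ω).toNat : ℝ≥0∞) ∂P ≤ ENNReal.ofReal (mu f n) := by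
  induction n with
  | zero => simp [Z, mu]
  | succ n ih =>
    have h := setLIntegral_toNat_Z_succ_le hX n (A := Set.univ) MeasurableSet.univ
    simp only [Measure.restrict_univ] at h
    refine h.trans ((mul_le_mul_right ih _).trans (le_of_eq ?_))
    rw [mu, mu, Finset.prod_range_succ, ENNReal.ofReal_mul
      (Finset.prod_nonneg fun i _ => ENNReal.toReal_nonneg),
      ENNReal.ofReal_toReal (hX.deriv_lt_top n).ne, mul_comm]

theorem setLIntegral_normZ (hX : IsOffspringFamily P f X) (n : ℕ) (A : Set Ω) :
    ∫⁻ ω in A, ENNReal.ofReal (normZ f X n ω) ∂P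
      = (∫⁻ ω in A, ((Z X n ω).toNat : ℝ≥0∞) ∂P) / ENNReal.ofReal (mu f n) := by
  have hμ := mu_pos hX.deriv_pos hX.deriv_lt_top n
  simp only [normZ, ENNReal.ofReal_div_of_pos hμ, ENNReal.ofReal_natCast]
  simp only [div_eq_mul_inv]
  exact lintegral_mul_const _ (measurable_comp_Z hX (fun z => (z.toNat : ℝ≥0∞)) n)

theorem lintegral_normZ_le [IsProbabilityMeasure P] (hX : IsOffspringFamily P f X) (n : ℕ) :
    ∫⁻ ω, ENNReal.ofReal (normZ f X n ω) ∂P ≤ 1 := by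
  have h := setLIntegral_normZ hX n Set.univ
  simp only [Measure.restrict_univ] at h
  rw [h]
  exact ENNReal.div_le_of_le_mul (by simpa using lintegral_toNat_Z_le hX n)

theorem measurable_normZ (hX : IsOffspringFamily P f X) (n : ℕ) : Measurable (normZ f X n) :=
  measurable_comp_Z hX (fun z => (z.toNat : ℝ) / mu f n) n

theorem supermartingale_normZ [IsProbabilityMeasure P] (hX : IsOffspringFamily P f X) :
    Supermartingale (normZ f X) (offspringFiltration hX.measurable) P := by
  have hint : ∀ n, Integrable (normZ f X n) P := fun n =>
    ⟨(measurable_normZ hX n).aestronglyMeasurable, by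
      rw [hasFiniteIntegral_iff_ofReal (Eventually.of_forall (normZ_nonneg n))]
      exact (lintegral_normZ_le hX n).trans_lt ENNReal.one_lt_top⟩
  refine supermartingale_of_setIntegral_succ_le (fun n => ?_) hint fun n A hA => ?_
  · refine Measurable.stronglyMeasurable ?_
    exact (measurable_of_countable fun z : NatDelta => (z.toNat : ℝ) / mu f n).comp (measurable_Z n)
  · have hnn : ∀ n, 0 ≤ᵐ[P.restrict A] normZ f X n :=
      fun n => Eventually.of_forall (normZ_nonneg n)
    rw [integral_eq_lintegral_of_nonneg_ae (hnn _) (measurable_normZ hX _).aestronglyMeasurable,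
      integral_eq_lintegral_of_nonneg_ae (hnn _) (measurable_normZ hX _).aestronglyMeasurable]
    refine ENNReal.toReal_mono ?_ ?_
    · exact ne_top_of_le_ne_top ENNReal.one_ne_top
        ((setLIntegral_le_lintegral _ _).trans (lintegral_normZ_le hX n))
    · rw [setLIntegral_normZ hX, setLIntegral_normZ hX]
      have hμ := mu_pos hX.deriv_pos hX.deriv_lt_top n
      have hm : mu f (n + 1) = mu f n * (derivOne (f n)).toReal := Finset.prod_range_succ _ _
      rw [hm, ENNReal.ofReal_mul hμ.le, ENNReal.ofReal_toReal (hX.deriv_lt_top n).ne]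
      refine (ENNReal.div_le_div_right (setLIntegral_toNat_Z_succ_le hX n hA) _).trans_eq ?_
      rw [mul_comm (ENNReal.ofReal _),
        ENNReal.mul_div_mul_left _ _ (hX.deriv_pos n).ne' (hX.deriv_lt_top n).ne]

theorem exists_tendsto_normZ [IsProbabilityMeasure P] (hX : IsOffspringFamily P f X) :
    ∃ W : Ω → ℝ, StronglyMeasurable[⨆ n, offspringFiltration hX.measurable n] W ∧
      (∀ ω, 0 ≤ W ω) ∧ ∀ᵐ ω ∂P, Tendsto (fun n => normZ f X n ω) atTop (𝓝 (W ω)) := by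
  set ℱ := offspringFiltration hX.measurable
  have hsub : Submartingale (-normZ f X) ℱ P := (supermartingale_normZ hX).neg
  have hlim := hsub.ae_tendsto_limitProcess (R := 1) fun n => by
    rw [Pi.neg_apply, eLpNorm_neg, eLpNorm_one_eq_lintegral_enorm]
    refine le_trans (le_of_eq (lintegral_congr fun ω => ?_)) (lintegral_normZ_le hX n)
    exact Real.enorm_of_nonneg (normZ_nonneg n ω)
  -- The maximum with `0` gives non-negativity everywhere and changes nothing where the limit
  -- exists.
  refine ⟨fun ω => max (-(Filtration.limitProcess (-normZ f X) ℱ P ω)) 0, ?_, fun ω => le_max_right _ _, ?_⟩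
  · exact (continuous_neg.max continuous_const).comp_stronglyMeasurable
      Filtration.stronglyMeasurable_limitProcess
  · filter_upwards [hlim] with ω hω
    have h1 := hω.neg
    simp only [Pi.neg_apply, neg_neg] at h1
    rwa [max_eq_left (ge_of_tendsto' h1 fun n => normZ_nonneg n ω)]

theorem integrable_powDelta_Z [IsProbabilityMeasure P] (hX : IsOffspringFamily P f X) {s : ℝ}
    (hs : s ∈ Set.Icc (0 : ℝ) 1) (n : ℕ) : Integrable (fun ω => powDelta s (Z X n ω)) P :=
  Integrable.of_bound (measurable_comp_Z hX (powDelta s) n).aestronglyMeasurable 1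
    (Eventually.of_forall fun ω => by
      rw [Real.norm_of_nonneg (powDelta_mem hs _).1]
      exact (powDelta_mem hs _).2)

theorem measurableSet_aliveSet (hX : IsOffspringFamily P f X) :
    MeasurableSet[⨆ n, offspringFiltration hX.measurable n] (aliveSet X) := by
  have : aliveSet X = ⋂ n, Z X n ⁻¹' {0, grave}ᶜ := by
    ext ω; simp [aliveSet, not_or]
  rw [this]
  refine MeasurableSet.iInter fun n => ?_
  exact le_iSup (fun n => (offspringFiltration hX.measurable n : MeasurableSpace Ω)) n _
    (measurable_Z n (MeasurableSet.of_discrete))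

/-- Uniformly in the past, survival entails a proportional probability of a small `s`-power. -/
theorem mul_measureReal_alive_le [IsProbabilityMeasure P] (hX : IsOffspringFamily P f X) {c K : ℝ}
    (hK : 1 ≤ K) (hcK : 4 * c ≤ K) (hc : 0 < c)
    (hcond : ∀ n, truncMoment (f n) 2 2 ≤
      ENNReal.ofReal c * truncMoment (f n) 1 2 * condMean (f n)) (n k : ℕ) {A : Set Ω}
    (hA : MeasurableSet[offspringAlg X (Set.Iio n)] A) :
    1 / (K + 1) * P.real (A ∩ aliveSet X) ≤
      ∫ ω in A, (1 - powDelta (Real.exp (-(mu f n / mu f (n + k)))) (Z X (n + k) ω)) ∂P := by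
  set s := Real.exp (-(mu f n / mu f (n + k))) with hs
  have hμ := mu_pos hX.deriv_pos hX.deriv_lt_top
  have hs01 : s ∈ Set.Icc (0 : ℝ) 1 :=
    ⟨(Real.exp_pos _).le, Real.exp_le_one_iff.2 (neg_nonpos.2 (div_pos (hμ _) (hμ _)).le)⟩
  have h0 : (0 : ℝ) ∈ Set.Icc (0 : ℝ) 1 := by simp
  have h1 : (1 : ℝ) ∈ Set.Icc (0 : ℝ) 1 := by simp
  have hAm : MeasurableSet A := offspringAlg_le hX.measurable _ A hA
  have hSm : MeasurableSet (aliveSet X) :=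
    (iSup_le fun n => (offspringFiltration hX.measurable).le n) _ (measurableSet_aliveSet hX)
  have hi : ∀ {s : ℝ}, s ∈ Set.Icc (0 : ℝ) 1 → ∀ n,
      Integrable (fun ω => powDelta s (Z X n ω)) (P.restrict A) :=
    fun hs n => (integrable_powDelta_Z hX hs n).restrict
  have hc0 : 0 ≤ 1 / (K + 1) := by positivity
  have hc1 : 1 / (K + 1) ≤ 1 := (div_le_one (by linarith)).2 (by linarith)
  have step : P.real (A ∩ aliveSet X)
      ≤ ∫ ω in A, (powDelta 1 (Z X (n + k) ω) - powDelta 0 (Z X (n + k) ω)) ∂P := by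
    rw [Set.inter_comm, ← measureReal_restrict_apply hSm, ← integral_indicator_one hSm]
    refine integral_mono ((integrable_const 1).indicator hSm) ((hi h1 _).sub (hi h0 _)) fun ω => ?_
    by_cases hω : ω ∈ aliveSet X
    · have := hω (n + k)
      simp [hω, powDelta_one_sub_zero _ this.1 this.2]
    · simpa [hω] using powDelta_one_sub_zero_nonneg (Z X (n + k) ω)
  refine (mul_le_mul_of_nonneg_left step hc0).trans ?_
  have ha := iterGen_mem f n k h1
  have hb := iterGen_mem f n k h0
  have hu := iterGen_mem f n k hs01
  rw [integral_sub (hi h1 _) (hi h0 _), integral_sub (integrable_const _) (hi hs01 _),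
    setIntegral_powDelta_Z_add hX h1 n k hA, setIntegral_powDelta_Z_add hX h0 n k hA,
    setIntegral_powDelta_Z_add hX hs01 n k hA, ← integral_sub (hi ha _) (hi hb _),
    ← integral_sub (integrable_const _) (hi hu _), ← integral_const_mul]
  refine integral_mono (((hi ha _).sub (hi hb _)).const_mul _)
    ((integrable_const _).sub (hi hu _)) fun ω => ?_
  -- The one-particle comparison is raised to the `Z X n ω` particles alive at time `n`.
  exact mul_powDelta_sub_le hb.1 (iterGen_mono f n k le_rfl zero_le_one le_rfl) ha.2 hu.1 hc0 hc1
    (iterGen_sub_le hK hcK hX.deriv_pos hX.deriv_lt_top hc hcond n k) _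

/-- An event `E` of the limit σ-algebra with `c P(A ∩ E) ≤ P(A \ E)` for all events `A` of the
past is null. -/
theorem measure_eq_zero_of_forall_mul_le [IsProbabilityMeasure P] {ℱ : Filtration ℕ mΩ} {E : Set Ω}
    (hE : MeasurableSet[⨆ n, ℱ n] E) {c : ℝ} (hc : 0 < c)
    (h : ∀ n A, MeasurableSet[ℱ n] A → c * P.real (A ∩ E) ≤ P.real (A ∩ Eᶜ)) : P E = 0 := by
  have hEm : MeasurableSet E := (iSup_le fun n => ℱ.le n) _ hE
  -- All conditional expectations of `g` on the past are non-negative and converge a.s. to `g`, yet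
  -- `g = -c` on `E`.
  set g : Ω → ℝ := Eᶜ.indicator 1 - c • E.indicator 1 with hg
  have hi1 : Integrable (Eᶜ.indicator (1 : Ω → ℝ)) P := (integrable_const 1).indicator hEm.compl
  have hi2 : Integrable (c • E.indicator (1 : Ω → ℝ)) P :=
    ((integrable_const 1).indicator hEm).smul c
  have hgi : Integrable g P := hi1.sub hi2
  have hgm : StronglyMeasurable[⨆ n, ℱ n] g :=
    (stronglyMeasurable_one.indicator hE.compl).sub
      ((stronglyMeasurable_one.indicator hE).const_smul c)
  have hset : ∀ n A, MeasurableSet[ℱ n] A → 0 ≤ ∫ ω in A, g ω ∂P := fun n A hA => by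
    have e : ∫ ω in A, g ω ∂P = P.real (A ∩ Eᶜ) - c * P.real (A ∩ E) := by
      rw [hg, integral_sub' hi1.restrict hi2.restrict]
      simp only [Pi.smul_apply, smul_eq_mul]
      rw [integral_const_mul, integral_indicator_one hEm.compl, integral_indicator_one hEm,
        measureReal_restrict_apply hEm.compl, measureReal_restrict_apply hEm,
        Set.inter_comm A, Set.inter_comm A]
    rw [e]
    exact sub_nonneg.2 (h n A hA)
  have hnn : ∀ n, 0 ≤ᵐ[P] P[g | ℱ n] := fun n => by
    refine ae_le_of_ae_le_trim (hm := ℱ.le n) ?_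
    refine ae_nonneg_of_forall_setIntegral_nonneg
      (integrable_condExp.trim (ℱ.le n) stronglyMeasurable_condExp) fun A hA _ => ?_
    rw [← setIntegral_trim (ℱ.le n) stronglyMeasurable_condExp hA,
      setIntegral_condExp (ℱ.le n) hgi hA]
    exact hset n A hA
  have hlim := hgi.tendsto_ae_condExp hgm
  refine measure_eq_zero_iff_ae_notMem.2 ?_
  filter_upwards [hlim, ae_all_iff.2 hnn] with ω h1 h2 hω
  have h3 : 0 ≤ g ω := ge_of_tendsto' h1 h2
  have h4 : g ω = -c := by simp [hg, hω]
  linarith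

theorem measure_alive_inter_eq_zero [IsProbabilityMeasure P] (hX : IsOffspringFamily P f X)
    {c : ℝ} (hc : 0 < c) (hcond : ∀ n, truncMoment (f n) 2 2 ≤
      ENNReal.ofReal c * truncMoment (f n) 1 2 * condMean (f n)) {W : Ω → ℝ}
    (hW : StronglyMeasurable[⨆ n, offspringFiltration hX.measurable n] W) (hW0 : ∀ ω, 0 ≤ W ω)
    (hlim : ∀ᵐ ω ∂P, Tendsto (fun n => normZ f X n ω) atTop (𝓝 (W ω))) :
    P (aliveSet X ∩ {ω | W ω = 0}) = 0 := by
  set K := max 1 (4 * c)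
  have hK : 1 ≤ K := le_max_left _ _
  have hle : (⨆ n, (offspringFiltration hX.measurable n : MeasurableSpace Ω)) ≤ mΩ :=
    iSup_le fun n => (offspringFiltration hX.measurable).le n
  have hS := measurableSet_aliveSet hX
  have hW' : MeasurableSet[⨆ n, offspringFiltration hX.measurable n] {ω | W ω = 0} :=
    hW.measurable (measurableSet_singleton 0)
  have hE := hS.inter hW'
  have hSm : MeasurableSet (aliveSet X) := hle _ hS
  have hEm : MeasurableSet (aliveSet X ∩ {ω | W ω = 0}) := hle _ hE
  refine measure_eq_zero_of_forall_mul_le hE (c := 1 / (K + 1)) (by positivity) fun n A hA => ?_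
  have hAm : MeasurableSet A := (offspringFiltration hX.measurable).le n A hA
  set lam := mu f n
  have hlam : 0 < lam := mu_pos hX.deriv_pos hX.deriv_lt_top n
  -- Off survival `1 - s ^ Z` is replaced by its trivial bound `1`: in `Δ` it is not a function of
  -- `normZ`, and that region lies in the complement of `E` anyway.
  set u : ℕ → Ω → ℝ := fun N =>
    (aliveSet X).indicator (fun ω => 1 - Real.exp (-(lam * normZ f X N ω)))
      + (aliveSet X)ᶜ.indicator 1 with hu
  set v : Ω → ℝ :=
    (aliveSet X).indicator (fun ω => 1 - Real.exp (-(lam * W ω))) + (aliveSet X)ᶜ.indicator 1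
    with hv
  have hWm : Measurable W := (hW.mono hle).measurable
  have hum : ∀ N, Measurable (u N) := fun N =>
    ((measurable_const.sub (((measurable_normZ hX N).const_mul _).neg.exp)).indicator hSm).add
      (measurable_one.indicator hSm.compl)
  have hvm : Measurable v :=
    ((measurable_const.sub ((hWm.const_mul _).neg.exp)).indicator hSm).add
      (measurable_one.indicator hSm.compl)
  have hexp : ∀ x : ℝ, 0 ≤ x → 0 ≤ 1 - Real.exp (-(lam * x)) ∧ 1 - Real.exp (-(lam * x)) ≤ 1 :=
    fun x hx => ⟨sub_nonneg.2 (Real.exp_le_one_iff.2 (neg_nonpos.2 (by positivity))),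
      by linarith [Real.exp_pos (-(lam * x))]⟩
  have hub : ∀ N ω, ‖u N ω‖ ≤ 1 := fun N ω => by
    have := hexp _ (normZ_nonneg (f := f) (X := X) N ω)
    by_cases hω : ω ∈ aliveSet X
    · simpa [hu, hω, abs_of_nonneg this.1] using (Real.exp_pos _).le
    · simp [hu, hω]
  have hvb : ∀ ω, ‖v ω‖ ≤ 1 := fun ω => by
    have := hexp _ (hW0 ω)
    by_cases hω : ω ∈ aliveSet X
    · simpa [hv, hω, abs_of_nonneg this.1] using (Real.exp_pos _).le
    · simp [hv, hω]
  have hui : ∀ N, Integrable (u N) (P.restrict A) := fun N =>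
    Integrable.of_bound (hum N).aestronglyMeasurable 1 (Eventually.of_forall (hub N))
  have hvi : Integrable v (P.restrict A) :=
    Integrable.of_bound hvm.aestronglyMeasurable 1 (Eventually.of_forall hvb)
  have htend : Tendsto (fun N => ∫ ω in A, u N ω ∂P) atTop (𝓝 (∫ ω in A, v ω ∂P)) := by
    refine tendsto_integral_of_dominated_convergence (fun _ => 1)
      (fun N => (hum N).aestronglyMeasurable) (integrable_const _)
      (fun N => Eventually.of_forall (hub N)) ?_
    filter_upwards [ae_restrict_of_ae hlim] with ω hω
    by_cases hS : ω ∈ aliveSet X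
    · simpa [hu, hv, hS] using ((Real.continuous_exp.tendsto _).comp
        (hω.const_mul lam).neg).const_sub 1
    · simp [hu, hv, hS]
  have hbound : ∀ k, 1 / (K + 1) * P.real (A ∩ aliveSet X) ≤ ∫ ω in A, u (k + n) ω ∂P := fun k => by
    refine (mul_measureReal_alive_le hX hK (le_max_right _ _) hc hcond n k hA).trans ?_
    rw [add_comm k n]
    have hs01 : Real.exp (-(lam / mu f (n + k))) ∈ Set.Icc (0 : ℝ) 1 :=
      ⟨(Real.exp_pos _).le, Real.exp_le_one_iff.2 (neg_nonpos.2
        (div_pos hlam (mu_pos hX.deriv_pos hX.deriv_lt_top _)).le)⟩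
    refine integral_mono ((integrable_const _).sub (integrable_powDelta_Z hX hs01 _).restrict)
      (hui _) fun ω => ?_
    by_cases hω : ω ∈ aliveSet X
    · simp only [hu, Pi.add_apply, Set.indicator_of_mem hω,
        Set.indicator_of_notMem (Set.notMem_compl_iff.2 hω)]
      rw [powDelta_exp_neg_div lam (n + k) (hω (n + k)).2, add_zero]
    · simpa [hu, hω] using (powDelta_mem hs01 (Z X (n + k) ω)).1
  have h1 := ge_of_tendsto' ((tendsto_add_atTop_iff_nat n).2 htend) hbound
  -- `v ≤ 1` everywhere, and `v` vanishes on survival with `W = 0`.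
  have h2 : ∫ ω in A, v ω ∂P ≤ P.real (A ∩ (aliveSet X ∩ {ω | W ω = 0})ᶜ) := by
    rw [Set.inter_comm A, ← measureReal_restrict_apply hEm.compl,
      ← integral_indicator_one hEm.compl]
    refine integral_mono hvi ((integrable_const 1).indicator hEm.compl) fun ω => ?_
    by_cases hω : ω ∈ aliveSet X
    · by_cases hz : W ω = 0
      · simp [hv, hω, hz]
      · simpa [hv, hω, hz] using (Real.exp_pos _).le
    · simp [hv, hω]
  refine le_trans (mul_le_mul_of_nonneg_left (measureReal_mono ?_) (by positivity)) (h1.trans h2)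
  exact Set.inter_subset_inter_right A Set.inter_subset_left

end Limit

end DefectiveGW

theorem mainTheorem6 {Ω : Type*} [MeasurableSpace Ω] (P : MeasureTheory.Measure Ω)
    [MeasureTheory.IsProbabilityMeasure P]
    (f : ℕ → PMF DefectiveGW.NatDelta) (X : ℕ → ℕ → Ω → DefectiveGW.NatDelta)
    (hX : DefectiveGW.IsOffspringFamily P f X)
    (hcond : ∃ c : ℝ, 0 < c ∧ ∀ n, DefectiveGW.truncMoment (f n) 2 2 ≤
      ENNReal.ofReal c * DefectiveGW.truncMoment (f n) 1 2 * DefectiveGW.condMean (f n))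
    (hpos : 0 < P {ω | DefectiveGW.tauA X ω = ⊤}) :
    ∃ W : Ω → ℝ, Measurable W ∧ (∀ ω, 0 ≤ W ω) ∧
      ∀ᵐ ω ∂P, DefectiveGW.tauA X ω = ⊤ →
        Filter.Tendsto
          (fun n => ((DefectiveGW.Z X n ω).toNat : ℝ) / DefectiveGW.mu f n)
          Filter.atTop (nhds (W ω)) ∧
        0 < W ω := by
  obtain ⟨c, hc, hcond⟩ := hcond
  obtain ⟨W, hW, hW0, hlim⟩ := DefectiveGW.exists_tendsto_normZ hX
  have hnull := DefectiveGW.measure_alive_inter_eq_zero hX hc hcond hW hW0 hlim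
  refine ⟨W, (hW.mono (iSup_le fun n => Filtration.le _ n)).measurable, hW0, ?_⟩
  filter_upwards [hlim, measure_eq_zero_iff_ae_notMem.1 hnull] with ω h1 h2 hτ
  exact ⟨h1, (hW0 ω).lt_of_ne fun h => h2 ⟨DefectiveGW.mem_aliveSet_of_tauA hτ, h.symm⟩⟩
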